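/- Let $\mathcal M$ be a finite von Neumann algebra with predual $\mathcal M_*$ and a normal faithful finite trace $\tau$, and let $\mathcal D(\mathcal M)\subset\mathcal M_*$ be the set of normal states; a state is identified with its density $\rho\in L_1(\mathcal M,\tau)$, $\omega(a)=\tau(\rho a)$. Let $(\mathcal A,\mathcal H,l,r,\partial)$ be a first order differential structure on $\mathcal M$: $\mathcal A\subset\mathcal M$ is a weak$^*$ dense subalgebra, $\mathcal H$ is a Hilbert space, $l:\mathcal M\to\mathcal B(\mathcal H)$ and $r:\mathcal M^{\rm op}\to\mathcal B(\mathcal H)$ are commuting unital $*$-homomorphisms, and $\partial:\mathcal A\to\mathcal H$ is a closable linear map with $\partial(xy)=l(x)\partial y+r(y)\partial x$. Let either $\Lambda$ be an operator mean (in the sense of Kubo and Ando) on $\mathcal B(\mathcal H)_+$, and $\Lambda_\rho=\Lambda(l(\rho),r(\rho))$; or, more generally, let $\mathcal H=\bigoplus_{j\in\mathcal J}\mathcal H_j$ be a Hilbert sum of subspaces invariant under $l$ and $r$ (for example copies of $L_2(\mathcal M)$), let $\Lambda_j$ be an operator mean on $\mathcal B(\mathcal H_j)_+$ for each $j$, and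 $\Lambda_\rho=\bigoplus_j\Lambda_j(l(\rho)|_{\mathcal H_j},r(\rho)|_{\mathcal H_j})$. Put $\|V\|_\rho=\langle V,\Lambda_\rho V\rangle^{1/2}\in[0,\infty]$ for $V\in\mathcal H$; for an unbounded density $\rho$, $\langle V,\Lambda_\rho V\rangle:=\sup_{n\ge1}\langle V,\Lambda_{\rho_n}V\rangle$, where $\rho_n=\rho(1+\rho/n)^{-1}\in\mathcal M_+$. Let $\mathcal H_\rho$ be the completion of $\{V\in\mathcal H:\|V\|_\rho<\infty\}$ for $\|\cdot\|_\rho$, with inner product $\langle\cdot,\cdot\rangle_\rho$ extending $\langle V,\Lambda_\rho W\rangle$. For $x\in\mathcal M_*$ and a density $\rho$ let $$\|x\|_{g,\rho}^2=\inf\big\{\|V\|_\rho^2:\ V\in\mathcal H_\rho,\ x=\partial^*(\Lambda_\rho V)\big\}\in[0,\infty],$$ where $x=\partial^*(\Lambda_\rho V)$ means that $x(a)=\langle V,\partial a\rangle_\rho$ for all $a\in\mathcal A$ with $\|\partial a\|_\rho<\infty$. For $\omega_1,\omega_2\in\mathcal D(\mathcal M)$ let $$W_{\partial,2}(\omega_1,\omega_2)=\inf_\gamma\int_0^1\|\dot\gamma(t)\|_{g,\gamma(t)}\,dt\in[0,\infty],$$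 the infimum being over all absolutely continuous, almost everywhere differentiable curves $\gamma:[0,1]\to\mathcal D(\mathcal M)\subset\mathcal M_*$ (for the norm of $\mathcal M_*$) with $\gamma(0)=\omega_1$, $\gamma(1)=\omega_2$. Let $\mathcal P:\mathcal M\to\mathcal M$ be a quantum channel (a normal unital completely positive map) and $\mathcal P^\dagger\omega=\omega\circ\mathcal P$ its pre-adjoint. Let $\kappa\le1$ and suppose that $\mathcal P$ satisfies the $\kappa$-gradient estimate: $\mathcal P(\mathcal A)\subset\mathcal A$, and for all $x\in\mathcal A$ and all densities $\rho$ with $\|\partial x\|_{\mathcal P^\dagger\rho}<\infty$, $$\|\partial\mathcal P(x)\|_\rho\le(1-\kappa)\,\|\partial x\|_{\mathcal P^\dagger\rho}.$$ Then for all $\omega_1,\omega_2\in\mathcal D(\mathcal M)$, $$W_{\partial,2}(\omega_1\circ\mathcal P,\omega_2\circ\mathcal P)\le(1-\kappa)\,W_{\partial,2}(\omega_1,\omega_2),$$ where in the case $\kappa=1$ it is assumed that $W_{\partial,2}(\omega_1,\omega_2)<\infty$ (so that no product $0\cdot\infty$ occurs). -/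

import Mathlib

open scoped ComplexOrder ENNReal InnerProductSpace Topology CStarAlgebra

noncomputable section

namespace QuantumTransport

/-! ### Von Neumann algebras, states, traces and channels -/

section Algebra

variable {M X : Type*} [CStarAlgebra M] [PartialOrder M] [StarOrderedRing M]
  [NormedAddCommGroup X] [NormedSpace ℂ X] [CompleteSpace X]

/-- The value at `a` of the normal functional `φ`. A von Neumann algebra is given by a C*-algebra
`M` and a Banach space `X` of which `M` is the dual, through `e : M ≃ X*`; thus `X` is the predual
`M_*`, its elements are the normal functionals on `M`. -/
def pair (e : M ≃ₗᵢ[ℂ] StrongDual ℂ X) (φ : X) (a : M) : ℂ := e a φ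

/-- The set `D(M)` of normal states, as a subset of the predual. -/
def normalStates (e : M ≃ₗᵢ[ℂ] StrongDual ℂ X) : Set X :=
  {ω | (∀ a : M, 0 ≤ a → 0 ≤ pair e ω a) ∧ pair e ω 1 = 1}

/-- `τ` is a normal faithful finite trace on `M` (not necessarily normalized). -/
structure IsFaithfulTrace (e : M ≃ₗᵢ[ℂ] StrongDual ℂ X) (τ : X) : Prop where
  nonneg : ∀ a : M, 0 ≤ a → 0 ≤ pair e τ a
  tracial : ∀ a b : M, pair e τ (a * b) = pair e τ (b * a)
  faithful : ∀ a : M, pair e τ (star a * a) = 0 → a = 0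

/-- A quantum channel: a completely positive unital map `P : M → M` which is normal, that is, has
a pre-adjoint `P† : M_* → M_*`, where `P† φ = φ ∘ P`. -/
structure QuantumChannel (e : M ≃ₗᵢ[ℂ] StrongDual ℂ X) extends M →CP M where
  map_one' : toFun 1 = 1
  preadjoint : X →L[ℂ] X
  pair_preadjoint' : ∀ (φ : X) (a : M), pair e (preadjoint φ) a = pair e φ (toFun a)

/-- Let `ρ` be the density of the normal state `ω` with respect to `τ`, that is,
`ω a = τ (ρ a)`; this is a positive operator affiliated to `M`, in general unbounded. Then
`IsTruncation e τ ω n h` says that `h` is the bounded operator `ρ (1 + ρ / n)⁻¹`, the `n`-th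
Yosida approximation of `ρ`: the displayed identity reads `ρ = h + ρ h / n`. For each `n > 0`
there is exactly one such `h`; these operators increase with `n`, and their supremum is `ρ`. -/
structure IsTruncation (e : M ≃ₗᵢ[ℂ] StrongDual ℂ X) (τ ω : X) (n : ℕ) (h : M) : Prop where
  pos : 0 < n
  nonneg : 0 ≤ h
  resolvent : ∀ a : M, pair e ω a = pair e τ (h * a) + (n : ℂ)⁻¹ * pair e ω (h * a)

end Algebra

/-! ### Operator means -/

/-- An operator mean in the sense of Kubo and Ando on the positive bounded operators on `K`;
the values of `toFun` at pairs of operators that are not both positive play no role. -/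
structure OperatorMean (K : Type*) [NormedAddCommGroup K] [InnerProductSpace ℂ K]
    [CompleteSpace K] where
  toFun : (K →L[ℂ] K) → (K →L[ℂ] K) → (K →L[ℂ] K)
  nonneg : ∀ A B, 0 ≤ A → 0 ≤ B → 0 ≤ toFun A B
  mono : ∀ A₁ A₂ B₁ B₂, 0 ≤ A₁ → 0 ≤ B₁ → A₁ ≤ A₂ → B₁ ≤ B₂ → toFun A₁ B₁ ≤ toFun A₂ B₂
  transformer : ∀ A B C, 0 ≤ A → 0 ≤ B → 0 ≤ C →
    C * toFun A B * C ≤ toFun (C * A * C) (C * B * C)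
  continuous_above : ∀ (A B : ℕ → K →L[ℂ] K) (A' B' : K →L[ℂ] K), Antitone A → Antitone B →
    (∀ n, 0 ≤ A n) → (∀ n, 0 ≤ B n) →
    (∀ v, Filter.Tendsto (fun n => A n v) Filter.atTop (𝓝 (A' v))) →
    (∀ v, Filter.Tendsto (fun n => B n v) Filter.atTop (𝓝 (B' v))) →
    ∀ v, Filter.Tendsto (fun n => toFun (A n) (B n) v) Filter.atTop (𝓝 (toFun A' B' v))
  map_one : toFun 1 1 = 1

/-! ### First order differential structures and the weighted norms -/

section Structure

variable {M X H : Type*} [CStarAlgebra M] [PartialOrder M] [StarOrderedRing M]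
  [NormedAddCommGroup X] [NormedSpace ℂ X] [CompleteSpace X]
  [NormedAddCommGroup H] [InnerProductSpace ℂ H] [CompleteSpace H]

/-- A first order differential structure `(A, H, l, r, ∂)` on `M`. The derivation is only required
to be closable with respect to the norm topology of `M`, which follows from closedness or
closability with respect to the norm of `M`, its weak* topology or the `L₂`-norm of a trace. -/
structure FirstOrderStructure (e : M ≃ₗᵢ[ℂ] StrongDual ℂ X) (H : Type*) [NormedAddCommGroup H]
    [InnerProductSpace ℂ H] [CompleteSpace H] where
  /-- the domain of the derivation, a weak* dense subalgebra of `M` -/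
  A : NonUnitalSubalgebra ℂ M
  dense : Dense ((fun a : M => StrongDual.toWeakDual (e a)) '' (A : Set M))
  /-- the left action -/
  l : M →⋆ₐ[ℂ] (H →L[ℂ] H)
  /-- the right action -/
  r : Mᵐᵒᵖ →⋆ₐ[ℂ] (H →L[ℂ] H)
  commute : ∀ (a : M) (b : Mᵐᵒᵖ), Commute (l a) (r b)
  /-- the derivation -/
  d : A →ₗ[ℂ] H
  leibniz : ∀ x y : A, d (x * y) = l (x : M) (d y) + r (MulOpposite.op (y : M)) (d x)
  closable : ∀ (a : ℕ → A) (ξ : H),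
    Filter.Tendsto (fun n => (a n : M)) Filter.atTop (𝓝 0) →
    Filter.Tendsto (fun n => d (a n)) Filter.atTop (𝓝 ξ) → ξ = 0

/-- The data that define the multiplication operators `Λ_ρ`: a decomposition of `H` into a Hilbert
sum of spaces `K j`, each of them invariant under both actions, and an operator mean on each
`K j`. A single mean `Λ` on `H` is the case of one summand `K = H`; a family `Λ_j` on a direct sum
of copies of `L₂(M)` is the case where all `K j` are `L₂(M)`. -/
structure MeanFamily {e : M ≃ₗᵢ[ℂ] StrongDual ℂ X} (S : FirstOrderStructure e H) {J : Type*}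
    (K : J → Type*) [∀ j, NormedAddCommGroup (K j)] [∀ j, InnerProductSpace ℂ (K j)]
    [∀ j, CompleteSpace (K j)] where
  U : ∀ j, K j →ₗᵢ[ℂ] H
  isHilbertSum : IsHilbertSum ℂ K U
  left_invariant : ∀ (j : J) (a : M) (v : K j), S.l a (U j v) ∈ Set.range (U j)
  right_invariant : ∀ (j : J) (a : Mᵐᵒᵖ) (v : K j), S.r a (U j v) ∈ Set.range (U j)
  mean : ∀ j, OperatorMean (K j)

end Structure

namespace MeanFamily

variable {M X H : Type*} [CStarAlgebra M] [PartialOrder M] [StarOrderedRing M]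
  [NormedAddCommGroup X] [NormedSpace ℂ X] [CompleteSpace X]
  [NormedAddCommGroup H] [InnerProductSpace ℂ H] [CompleteSpace H]
  {e : M ≃ₗᵢ[ℂ] StrongDual ℂ X} {S : FirstOrderStructure e H}
  {J : Type*} {K : J → Type*} [∀ j, NormedAddCommGroup (K j)] [∀ j, InnerProductSpace ℂ (K j)]
  [∀ j, CompleteSpace (K j)]

/-- The coordinate projection `H → K j`. -/
def proj (F : MeanFamily S K) (j : J) : H →L[ℂ] K j :=
  ContinuousLinearMap.adjoint (F.U j).toContinuousLinearMap

/-- The operator that `T`, an operator on `H` that leaves `K j` invariant, induces on `K j`. -/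
def compress (F : MeanFamily S K) (j : J) (T : H →L[ℂ] H) : K j →L[ℂ] K j :=
  F.proj j ∘L T ∘L (F.U j).toContinuousLinearMap

/-- The operator `Λ_j(l(h), r(h))` on `K j`, for a positive bounded `h`. -/
def weightOp (F : MeanFamily S K) (j : J) (h : M) : K j →L[ℂ] K j :=
  (F.mean j).toFun (F.compress j (S.l h)) (F.compress j (S.r (MulOpposite.op h)))

/-- The quadratic form `⟨V, Λ_h V⟩ = ∑ⱼ ⟨Vⱼ, Λ_j(l(h), r(h)) Vⱼ⟩`, for a positive bounded `h`. -/
def form (F : MeanFamily S K) (h : M) (V : H) : ℝ≥0∞ :=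
  ∑' j, ENNReal.ofReal (RCLike.re ⟪F.proj j V, F.weightOp j h (F.proj j V)⟫_ℂ)

/-- The closed quadratic form `⟨V, Λ_ρ V⟩ ∈ [0, ∞]` of the density `ρ` of the normal state `ω`:
the increasing limit of the forms of the bounded approximations of `ρ`. If `ρ` is bounded, then it
is equal to `form ρ V`. -/
def weightSq (F : MeanFamily S K) (τ ω : X) (V : H) : ℝ≥0∞ :=
  ⨆ (n : ℕ) (h : M) (_ : IsTruncation e τ ω n h), F.form h V

/-- The weighted norm `‖V‖_ρ = ⟨V, Λ_ρ V⟩^(1/2)`. -/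
def weightNorm (F : MeanFamily S K) (τ ω : X) (V : H) : ℝ≥0∞ :=
  F.weightSq τ ω V ^ (1 / 2 : ℝ)

/-- The sesquilinear form `⟨V, Λ_ρ W⟩` for `V`, `W` of finite weighted norm, by polarization. -/
def weightInner (F : MeanFamily S K) (τ ω : X) (V W : H) : ℂ :=
  let q : H → ℂ := fun Z => ((F.weightSq τ ω Z).toReal : ℂ)
  (q (V + W) - q (V - W) + (q (V - Complex.I • W) - q (V + Complex.I • W)) * Complex.I) / 4

/-- `x = ∂* (Λ_ρ V)` and `⟨V, Λ_ρ V⟩ = E`, where `V` lies in the completion of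
`{V ∈ H | ‖V‖_ρ < ∞}` for the norm `‖·‖_ρ` and is given by a Cauchy sequence. The first equation is
meant in the dual sense, `x(a) = ⟨V, Λ_ρ ∂a⟩` for all `a` in the domain of `∂` for which the right
side is defined. -/
structure IsVelocity (F : MeanFamily S K) (τ ω x : X) (V : ℕ → H) (E : ℝ≥0∞) : Prop where
  finite : ∀ k, F.weightNorm τ ω (V k) < ∞
  cauchy : Filter.Tendsto (fun p : ℕ × ℕ => F.weightNorm τ ω (V p.1 - V p.2)) Filter.atTop (𝓝 0)
  energy : Filter.Tendsto (fun k => F.weightSq τ ω (V k)) Filter.atTop (𝓝 E)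
  divergence : ∀ a : S.A, F.weightNorm τ ω (S.d a) < ∞ →
    Filter.Tendsto (fun k => F.weightInner τ ω (V k) (S.d a)) Filter.atTop (𝓝 (pair e x a))

/-- The metric `‖x‖_{g,ρ}`, where
`‖x‖_{g,ρ}² = inf {⟨V, Λ_ρ V⟩ | x = ∂* (Λ_ρ V)}` (with value `∞` if there is no such `V`). -/
def tangentNorm (F : MeanFamily S K) (τ ω x : X) : ℝ≥0∞ :=
  (⨅ (V : ℕ → H) (E : ℝ≥0∞) (_ : F.IsVelocity τ ω x V E), E) ^ (1 / 2 : ℝ)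

end MeanFamily

/-! ### The transport distance and the gradient estimate -/

section Distance

variable {M X H : Type*} [CStarAlgebra M] [PartialOrder M] [StarOrderedRing M]
  [NormedAddCommGroup X] [NormedSpace ℂ X] [CompleteSpace X]
  [NormedAddCommGroup H] [InnerProductSpace ℂ H] [CompleteSpace H]
  {e : M ≃ₗᵢ[ℂ] StrongDual ℂ X} {S : FirstOrderStructure e H}
  {J : Type*} {K : J → Type*} [∀ j, NormedAddCommGroup (K j)] [∀ j, InnerProductSpace ℂ (K j)]
  [∀ j, CompleteSpace (K j)]

/-- `γ` is an absolutely continuous curve `[0, 1] → D(M)` from `ω₁` to `ω₂`, for the norm of the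
predual, with a derivative at almost every time (which is automatic in finite dimension). -/
structure IsCurve (e : M ≃ₗᵢ[ℂ] StrongDual ℂ X) (ω₁ ω₂ : X) (γ : ℝ → X) : Prop where
  start : γ 0 = ω₁
  finish : γ 1 = ω₂
  mem : ∀ t ∈ Set.Icc (0 : ℝ) 1, γ t ∈ normalStates e
  absolutelyContinuous : AbsolutelyContinuousOnInterval γ 0 1
  differentiable : ∀ᵐ t ∂MeasureTheory.volume.restrict (Set.Icc (0 : ℝ) 1), DifferentiableAt ℝ γ t

/-- The quantum Wasserstein 2-distance
`W_{∂,2}(ω₁, ω₂) = inf_γ ∫₀¹ ‖γ'(t)‖_{g,γ(t)} dt ∈ [0, ∞]`. -/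
def wasserstein (F : MeanFamily S K) (τ ω₁ ω₂ : X) : ℝ≥0∞ :=
  ⨅ (γ : ℝ → X) (_ : IsCurve e ω₁ ω₂ γ),
    ∫⁻ t in Set.Icc (0 : ℝ) 1, F.tangentNorm τ (γ t) (deriv γ t)

/-- The gradient estimate `‖∂ P x‖_ρ ≤ (1 - κ) ‖∂ x‖_{P† ρ}` for all `x` in the domain of `∂` and
all normal states; it is part of the estimate that `P` maps the domain of `∂` to itself. Nothing is
required where the norm on the right is infinite. -/
def GradientEstimate (F : MeanFamily S K) (τ : X) (P : QuantumChannel e) (κ : ℝ) : Prop :=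
  ∀ x : S.A, ∃ hx : P.toFun (x : M) ∈ S.A, ∀ ρ ∈ normalStates e,
    F.weightNorm τ (P.preadjoint ρ) (S.d x) < ∞ →
      F.weightNorm τ ρ (S.d ⟨P.toFun (x : M), hx⟩) ≤
        ENNReal.ofReal (1 - κ) * F.weightNorm τ (P.preadjoint ρ) (S.d x)

end Distance

end QuantumTransport

end

set_option linter.unusedSectionVars false

noncomputable section

namespace QuantumTransport

open Filter

/-! The tangent norm is a dual norm. If `x = ∂* (Λ_ρ V)`, Cauchy–Schwarz gives `|x(a)| ≤ ‖V‖_ρ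
‖∂a‖_ρ`; conversely, by Riesz representation in the completion, any bound `|y(a)| ≤ C ‖∂a‖_σ` yields
a velocity of `y` with energy at most `C²`. Testing `x` on `P a` and using the gradient estimate,
`|(P† x)(a)| = |x(P a)| ≤ ‖V‖_ρ ‖∂ P a‖_ρ ≤ (1 - κ) ‖V‖_ρ ‖∂a‖_{P† ρ}`, so `P†` contracts tangent
norms by `1 - κ` (`tangentNorm_preadjoint_le`). Since `P†` maps admissible curves to admissible
curves, integration and the infimum over curves finish the case `κ < 1`; the case `κ = 1` is a limit
of it.

Both halves of the duality need `⟨V, Λ_ρ V⟩` to come from a semidefinite inner product where it is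
finite (`isQuadratic_weightSq`). For bounded operators this is clear, and it survives the supremum
over truncations because they increase (`IsTruncation.mono`), which rests on a resolvent identity.
-/

/-! ### Extended quadratic forms and their polarization -/

section QuadraticForm

variable {D : Type*} [AddCommGroup D] [Module ℂ D]

/-- Identities that characterize the finite quadratic forms of positive semidefinite sesquilinear
forms. -/
structure IsRealQuadratic (p : D → ℝ) : Prop where
  nonneg : ∀ x, 0 ≤ p x
  smul : ∀ (z : ℂ) x, p (z • x) = ‖z‖ ^ 2 * p x
  -- `add` and `line` express additivity and positive homogeneity of `x ↦ p (x + z) - p (x - z)`,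
  -- with terms moved across so that no subtraction of values occurs. The same identities then make
  -- sense in `[0, ∞]`, and having `line` as an axiom replaces a continuity argument.
  add : ∀ x y z, p (x + y + z) + p (x - z) + p (y - z) = p (x + y - z) + p (x + z) + p (y + z)
  line : ∀ t : ℝ, 0 ≤ t → ∀ x z,
    p ((t : ℂ) • x + z) + t * p (x - z) = p ((t : ℂ) • x - z) + t * p (x + z)

/-- The polarization of `p`. -/
def polarize (p : D → ℝ) (x y : D) : ℂ :=
  ((p (x + y) : ℂ) - p (x - y)
    + ((p (x - Complex.I • y) : ℂ) - p (x + Complex.I • y)) * Complex.I) / 4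

namespace IsRealQuadratic

variable {p : D → ℝ} (hp : IsRealQuadratic p)
include hp

lemma smul_of_norm_eq_one {z : ℂ} (hz : ‖z‖ = 1) (x : D) : p (z • x) = p x := by
  simp [hp.smul, hz]

lemma neg (x : D) : p (-x) = p x := by
  simpa using hp.smul_of_norm_eq_one (z := -1) (by simp) x

lemma sub_comm (x y : D) : p (x - y) = p (y - x) := by
  rw [← hp.neg, neg_sub]

lemma polarize_self (x : D) : polarize p x x = p x := by
  have h1 : p (x + x) = 4 * p x := by
    rw [← two_smul ℂ x, hp.smul]; norm_num
  have h2 : p (x - x) = 0 := by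
    have := hp.smul 0 x
    simpa using this
  have h3 : p (x - Complex.I • x) = p (x + Complex.I • x) := by
    rw [← hp.smul_of_norm_eq_one (z := Complex.I) (by simp) (x - Complex.I • x)]
    congr 1
    rw [smul_sub, smul_smul, Complex.I_mul_I]
    module
  rw [polarize, h1, h2, h3]
  push_cast
  ring

lemma conj_polarize (x y : D) : (starRingEnd ℂ) (polarize p y x) = polarize p x y := by
  have h1 : p (y - Complex.I • x) = p (x + Complex.I • y) := by
    rw [← hp.smul_of_norm_eq_one (z := Complex.I) (by simp) (y - Complex.I • x)]
    congr 1
    rw [smul_sub, smul_smul, Complex.I_mul_I]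
    module
  have h2 : p (y + Complex.I • x) = p (x - Complex.I • y) := by
    rw [← hp.smul_of_norm_eq_one (z := -Complex.I) (by simp) (y + Complex.I • x)]
    congr 1
    rw [smul_add, smul_smul, neg_mul, Complex.I_mul_I]
    module
  simp only [polarize, map_div₀, map_add, map_sub, map_mul, Complex.conj_ofReal, Complex.conj_I,
    map_ofNat, h1, h2, hp.sub_comm y x, add_comm y x]
  ring

/-- The identity `add` at `z` handles the real part, at `I • z` the imaginary part. -/
lemma polarize_add_left (x y z : D) :
    polarize p (x + y) z = polarize p x z + polarize p y z := by
  have h1 := congrArg (fun s : ℝ => (s : ℂ)) (hp.add x y z)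
  have h2 := congrArg (fun s : ℝ => (s : ℂ)) (hp.add x y (Complex.I • z))
  push_cast at h1 h2
  simp only [polarize]
  linear_combination (1 / 4) * h1 - (Complex.I / 4) * h2

lemma polarize_neg_left (x z : D) : polarize p (-x) z = -polarize p x z := by
  have h (w : D) : p (-x + w) = p (x - w) := by rw [← hp.neg]; congr 1; abel
  have h' (w : D) : p (-x - w) = p (x + w) := by rw [← hp.neg]; congr 1; abel
  simp only [polarize, h, h']
  ring

lemma polarize_real_smul_left (t : ℝ) (x z : D) :
    polarize p ((t : ℂ) • x) z = t * polarize p x z := by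
  have key : ∀ t : ℝ, 0 ≤ t → polarize p ((t : ℂ) • x) z = t * polarize p x z := by
    intro t ht
    have h1 := congrArg (fun s : ℝ => (s : ℂ)) (hp.line t ht x z)
    have h2 := congrArg (fun s : ℝ => (s : ℂ)) (hp.line t ht x (Complex.I • z))
    push_cast at h1 h2
    simp only [polarize]
    linear_combination (1 / 4) * h1 - (Complex.I / 4) * h2
  rcases le_total 0 t with ht | ht
  · exact key t ht
  · have := key (-t) (by linarith)
    rw [Complex.ofReal_neg, neg_smul, hp.polarize_neg_left] at this
    linear_combination -this

lemma polarize_I_smul_left (x z : D) :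
    polarize p (Complex.I • x) z = -Complex.I * polarize p x z := by
  have h1 : p (Complex.I • x + z) = p (x - Complex.I • z) := by
    rw [← hp.smul_of_norm_eq_one (z := -Complex.I) (by simp) (_ + z), smul_add, smul_smul, neg_mul,
      Complex.I_mul_I]
    congr 1; module
  have h2 : p (Complex.I • x - z) = p (x + Complex.I • z) := by
    rw [← hp.smul_of_norm_eq_one (z := -Complex.I) (by simp) (_ - z), smul_sub, smul_smul, neg_mul,
      Complex.I_mul_I]
    congr 1; module
  simp only [polarize, h1, h2, ← smul_sub, ← smul_add,
    hp.smul_of_norm_eq_one (z := Complex.I) (by simp)]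
  linear_combination ((p (x - Complex.I • z) : ℂ) - p (x + Complex.I • z)) / 4 * Complex.I_sq

lemma polarize_smul_left (x z : D) (c : ℂ) :
    polarize p (c • x) z = (starRingEnd ℂ) c * polarize p x z := by
  conv_lhs => rw [← Complex.re_add_im c]
  rw [add_smul, hp.polarize_add_left, hp.polarize_real_smul_left, mul_smul,
    hp.polarize_real_smul_left, hp.polarize_I_smul_left]
  conv_rhs => rw [← Complex.re_add_im c]
  simp only [map_add, map_mul, Complex.conj_ofReal, Complex.conj_I]
  ring

/-- The positive semidefinite inner product given by a finite quadratic form. -/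
@[reducible] def core : PreInnerProductSpace.Core ℂ D where
  inner := polarize p
  conj_inner_symm := hp.conj_polarize
  re_inner_nonneg x := by
    rw [hp.polarize_self]
    simpa using hp.nonneg x
  add_left := hp.polarize_add_left
  smul_left := hp.polarize_smul_left

lemma norm_polarize_le (x y : D) : ‖polarize p x y‖ ≤ √(p x) * √(p y) := by
  let _ := hp.core
  have h := InnerProductSpace.Core.norm_inner_le_norm (𝕜 := ℂ) x y
  rw [InnerProductSpace.Core.norm_eq_sqrt_re_inner (𝕜 := ℂ) x,
    InnerProductSpace.Core.norm_eq_sqrt_re_inner (𝕜 := ℂ) y] at h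
  change ‖polarize p x y‖ ≤ √(RCLike.re (polarize p x x)) * √(RCLike.re (polarize p y y)) at h
  rw [hp.polarize_self, hp.polarize_self] at h
  simpa using h

end IsRealQuadratic

/-- A linear functional that is bounded by the norm of the image of its argument under `T` is
represented by a vector. -/
lemma exists_inner_eq_of_norm_le {E G : Type*} [AddCommGroup E] [Module ℂ E]
    [NormedAddCommGroup G] [InnerProductSpace ℂ G] [CompleteSpace G] (T : E →ₗ[ℂ] G)
    (f : E →ₗ[ℂ] ℂ) {C : ℝ} (hC : 0 ≤ C) (hf : ∀ a, ‖f a‖ ≤ C * ‖T a‖) :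
    ∃ w : G, ‖w‖ ≤ C ∧ ∀ a, ⟪w, T a⟫_ℂ = f a := by
  -- By the bound, `f` vanishes on the kernel of `T`, so it descends to the range.
  have hker : LinearMap.ker T ≤ LinearMap.ker f := by
    intro a ha
    have := hf a
    rw [LinearMap.mem_ker.1 ha, norm_zero, mul_zero] at this
    simpa using this
  let g : LinearMap.range T →ₗ[ℂ] ℂ :=
    (LinearMap.ker T).liftQ f hker ∘ₗ T.quotKerEquivRange.symm.toLinearMap
  have hg (a : E) : g ⟨T a, LinearMap.mem_range_self T a⟩ = f a := by
    simp [g, LinearMap.quotKerEquivRange_symm_apply_image]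
  have hgb : ∀ y : LinearMap.range T, ‖g y‖ ≤ C * ‖y‖ := by
    rintro ⟨_, a, rfl⟩
    rw [hg]
    exact hf a
  -- The range need not be closed; Hahn–Banach extends the functional without increasing its norm.
  obtain ⟨G', hG', hn⟩ := exists_extension_norm_eq (LinearMap.range T) (g.mkContinuous C hgb)
  refine ⟨(InnerProductSpace.toDual ℂ G).symm G', ?_, fun a => ?_⟩
  · rw [LinearIsometryEquiv.norm_map, hn]
    exact LinearMap.mkContinuous_norm_le _ hC _
  · rw [InnerProductSpace.toDual_symm_apply]
    exact (hG' ⟨T a, LinearMap.mem_range_self T a⟩).trans (hg a)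

/-- The Riesz representation theorem in the completion of `D` for a finite quadratic form. -/
lemma IsRealQuadratic.exists_seq_polarize_tendsto {E : Type*} [AddCommGroup E] [Module ℂ E]
    {p : D → ℝ} (hp : IsRealQuadratic p) (T : E →ₗ[ℂ] D) (f : E →ₗ[ℂ] ℂ) {C : ℝ} (hC : 0 ≤ C)
    (hf : ∀ a, ‖f a‖ ≤ C * √(p (T a))) :
    ∃ (V : ℕ → D) (b : ℝ), b ≤ C ^ 2 ∧
      Tendsto (fun k : ℕ × ℕ => p (V k.1 - V k.2)) atTop (𝓝 0) ∧
      Tendsto (fun k => p (V k)) atTop (𝓝 b) ∧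
      ∀ a, Tendsto (fun k => polarize p (V k) (T a)) atTop (𝓝 (f a)) := by
  let c := hp.core
  let _ : SeminormedAddCommGroup D :=
    @InnerProductSpace.Core.toSeminormedAddCommGroup ℂ D _ _ _ c
  let _ : InnerProductSpace ℂ D := InnerProductSpace.ofCore c
  have hinner (x y : D) : ⟪x, y⟫_ℂ = polarize p x y := rfl
  have hnorm (x : D) : ‖x‖ ^ 2 = p x := by
    rw [← inner_self_eq_norm_sq (𝕜 := ℂ), hinner, hp.polarize_self]
    simp
  have hnorm' (x : D) : ‖x‖ = √(p x) := by
    rw [← hnorm, Real.sqrt_sq (norm_nonneg x)]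
  let ι : D →ₗ[ℂ] UniformSpace.Completion D :=
    (UniformSpace.Completion.toComplL (𝕜 := ℂ) (E := D)).toLinearMap
  have hι (x : D) : ι x = (x : UniformSpace.Completion D) := rfl
  obtain ⟨w, hw, hwf⟩ := exists_inner_eq_of_norm_le (ι ∘ₗ T) f hC (fun a => by
    rw [LinearMap.comp_apply, hι, UniformSpace.Completion.norm_coe, hnorm']
    exact hf a)
  -- The representing vector `w` lives in the completion only; a sequence from `D` converging to it
  -- provides `V`, with limiting energy `‖w‖ ^ 2`.
  obtain ⟨u, hu, hlim⟩ := mem_closure_iff_seq_limit.1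
    ((UniformSpace.Completion.denseRange_coe (α := D)) w)
  choose V hV using hu
  have hVw : Tendsto (fun k => (V k : UniformSpace.Completion D)) atTop (𝓝 w) := by
    simpa only [hV] using hlim
  refine ⟨V, ‖w‖ ^ 2, pow_le_pow_left₀ (norm_nonneg w) hw 2, ?_, ?_, fun a => ?_⟩
  · have h1 : Tendsto (fun k : ℕ × ℕ => (V k.1 : UniformSpace.Completion D) - V k.2) atTop
        (𝓝 (w - w)) := by
      rw [← prod_atTop_atTop_eq]
      exact (hVw.comp tendsto_fst).sub (hVw.comp tendsto_snd)
    have h2 := h1.norm.pow 2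
    simpa [← UniformSpace.Completion.coe_sub, UniformSpace.Completion.norm_coe, hnorm] using h2
  · have h2 := hVw.norm.pow 2
    simpa [UniformSpace.Completion.norm_coe, hnorm] using h2
  · have h2 : Tendsto (fun k => ⟪(V k : UniformSpace.Completion D), (T a : _)⟫_ℂ) atTop
        (𝓝 ⟪w, (T a : UniformSpace.Completion D)⟫_ℂ) := hVw.inner tendsto_const_nhds
    rw [← hwf a]
    simp only [UniformSpace.Completion.inner_coe, hinner] at h2
    exact h2

/-- Identities that characterize the quadratic forms of positive semidefinite sesquilinear forms
among the functions with values in `[0, ∞]`. -/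
structure IsQuadratic (q : D → ℝ≥0∞) : Prop where
  smul : ∀ (z : ℂ) x, q (z • x) = ENNReal.ofReal (‖z‖ ^ 2) * q x
  parallelogram : ∀ x y, q (x + y) + q (x - y) = 2 * q x + 2 * q y
  add : ∀ x y z, q (x + y + z) + q (x - z) + q (y - z) = q (x + y - z) + q (x + z) + q (y + z)
  line : ∀ t : ℝ, 0 ≤ t → ∀ x z,
    q ((t : ℂ) • x + z) + ENNReal.ofReal t * q (x - z)
      = q ((t : ℂ) • x - z) + ENNReal.ofReal t * q (x + z)

namespace IsQuadratic

lemma tsum {J : Type*} {q : J → D → ℝ≥0∞} (hq : ∀ j, IsQuadratic (q j)) :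
    IsQuadratic (fun x => ∑' j, q j x) := by
  constructor
  · intro z x
    simp only [(hq _).smul, ENNReal.tsum_mul_left]
  · intro x y
    simp only [← ENNReal.tsum_add, ← ENNReal.tsum_mul_left, (hq _).parallelogram]
  · intro x y z
    simp only [← ENNReal.tsum_add, (hq _).add]
  · intro t ht x z
    simp only [← ENNReal.tsum_add, ← ENNReal.tsum_mul_left, (hq _).line t ht]

/-- Each identity involves only sums and nonnegative multiples, and both commute with directed
suprema in `[0, ∞]`. -/
lemma iSup {ι : Type*} [Preorder ι] [IsDirectedOrder ι] {q : ι → D → ℝ≥0∞} (hmono : Monotone q)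
    (hq : ∀ i, IsQuadratic (q i)) : IsQuadratic (fun x => ⨆ i, q i x) := by
  have hm (x : D) : Monotone (fun i => q i x) := fun i j hij => hmono hij x
  have hmul (c : ℝ≥0∞) (x : D) : Monotone (fun i => c * q i x) := fun i j hij =>
    mul_le_mul_right (hm x hij) c
  have hadd (x y : D) : Monotone (fun i => q i x + q i y) := fun i j hij =>
    add_le_add (hm x hij) (hm y hij)
  constructor
  · intro z x
    simp only [(hq _).smul, ENNReal.mul_iSup]
  · intro x y
    simp only [ENNReal.mul_iSup]
    rw [ENNReal.iSup_add_iSup_of_monotone (hm _) (hm _),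
      ENNReal.iSup_add_iSup_of_monotone (hmul _ _) (hmul _ _)]
    simp only [(hq _).parallelogram]
  · intro x y z
    rw [ENNReal.iSup_add_iSup_of_monotone (hm _) (hm _),
      ENNReal.iSup_add_iSup_of_monotone (hm _) (hm _),
      ENNReal.iSup_add_iSup_of_monotone (hadd _ _) (hm _),
      ENNReal.iSup_add_iSup_of_monotone (hadd _ _) (hm _)]
    simp only [(hq _).add]
  · intro t ht x z
    simp only [ENNReal.mul_iSup]
    rw [ENNReal.iSup_add_iSup_of_monotone (hm _) (hmul _ _),
      ENNReal.iSup_add_iSup_of_monotone (hm _) (hmul _ _)]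
    simp only [(hq _).line t ht]

variable {q : D → ℝ≥0∞} (hq : IsQuadratic q)
include hq

/-- The subspace on which an extended quadratic form is finite. -/
def finiteDomain : Submodule ℂ D where
  carrier := {x | q x < ∞}
  zero_mem' := by
    have := hq.smul 0 0
    simp_all
  add_mem' {x y} hx hy := by
    refine lt_of_le_of_lt (le_self_add.trans (hq.parallelogram x y).le) ?_
    exact ENNReal.add_lt_top.2 ⟨ENNReal.mul_lt_top (by simp) hx, ENNReal.mul_lt_top (by simp) hy⟩
  smul_mem' z x hx := by
    change q (z • x) < ∞
    rw [hq.smul]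
    exact ENNReal.mul_lt_top (by simp) hx

lemma mem_finiteDomain {x : D} : x ∈ hq.finiteDomain ↔ q x < ∞ := Iff.rfl

lemma isRealQuadratic : IsRealQuadratic (fun x : hq.finiteDomain => (q x).toReal) := by
  have hfin (x : hq.finiteDomain) : q x ≠ ∞ := (hq.mem_finiteDomain.1 x.2).ne
  have hadd (x y : hq.finiteDomain) : (q x + q y).toReal = (q x).toReal + (q y).toReal :=
    ENNReal.toReal_add (hfin x) (hfin y)
  have hadd3 (x y z : hq.finiteDomain) :
      (q x + q y + q z).toReal = (q x).toReal + (q y).toReal + (q z).toReal := by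
    rw [ENNReal.toReal_add (ENNReal.add_ne_top.2 ⟨hfin x, hfin y⟩) (hfin z), hadd]
  have haddmul (x y : hq.finiteDomain) {t : ℝ} (ht : 0 ≤ t) :
      (q x + ENNReal.ofReal t * q y).toReal = (q x).toReal + t * (q y).toReal := by
    rw [ENNReal.toReal_add (hfin x) (ENNReal.mul_ne_top (by simp) (hfin y)), ENNReal.toReal_mul,
      ENNReal.toReal_ofReal ht]
  constructor
  · intro x
    exact ENNReal.toReal_nonneg
  · intro z x
    change (q (z • (x : D))).toReal = _
    rw [hq.smul, ENNReal.toReal_mul, ENNReal.toReal_ofReal (by positivity)]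
  · intro x y z
    rw [← hadd3, ← hadd3]
    exact congrArg ENNReal.toReal (hq.add x y z)
  · intro t ht x z
    rw [← haddmul _ _ ht, ← haddmul _ _ ht]
    exact congrArg ENNReal.toReal (hq.line t ht x z)

end IsQuadratic

end QuadraticForm

/-! ### Truncations of a density -/

section Truncation

variable {M X : Type*} [CStarAlgebra M] [PartialOrder M] [StarOrderedRing M]
  [NormedAddCommGroup X] [NormedSpace ℂ X] [CompleteSpace X] {e : M ≃ₗᵢ[ℂ] StrongDual ℂ X}

lemma pair_add (φ : X) (a b : M) : pair e φ (a + b) = pair e φ a + pair e φ b := by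
  simp [pair]

lemma pair_sub (φ : X) (a b : M) : pair e φ (a - b) = pair e φ a - pair e φ b := by
  simp [pair]

lemma pair_smul (φ : X) (c : ℂ) (a : M) : pair e φ (c • a) = c * pair e φ a := by
  simp [pair]

/-- A normal functional, as a linear functional on the algebra. -/
def pairLinear (e : M ≃ₗᵢ[ℂ] StrongDual ℂ X) (φ : X) : M →ₗ[ℂ] ℂ where
  toFun := pair e φ
  map_add' := pair_add φ
  map_smul' c a := pair_smul φ c a

/-- A positive functional is hermitian. -/
lemma pair_star_of_nonneg {φ : X} (hφ : ∀ a : M, 0 ≤ a → 0 ≤ pair e φ a) (a : M) :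
    pair e φ (star a) = star (pair e φ a) := by
  let f : M →ₚ[ℂ] ℂ := PositiveLinearMap.mk₀ (pairLinear e φ) hφ
  exact map_star f a

lemma IsFaithfulTrace.eq_zero_of_pair_mul {τ : X} (hτ : IsFaithfulTrace e τ) {b : M}
    (h : ∀ a, pair e τ (b * a) = 0) : b = 0 := by
  refine hτ.faithful b ?_
  rw [hτ.tracial]
  exact h _

namespace IsTruncation

variable {τ ω : X} {n m : ℕ} {h k : M}

/-- Formally, `h` commutes with `ρ`. Comparing the resolvent identity at `a` with the adjoint of the
one at `star a`, the trace terms agree by cyclicity, hence so do the `ω` terms. -/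
lemma pair_mul_comm (hτ : IsFaithfulTrace e τ) (hω : ∀ a : M, 0 ≤ a → 0 ≤ pair e ω a)
    (hh : IsTruncation e τ ω n h) (a : M) : pair e ω (h * a) = pair e ω (a * h) := by
  have hs : star h = h := (IsSelfAdjoint.of_nonneg hh.nonneg).star_eq
  have h1 := hh.resolvent a
  have h2 := congrArg star (hh.resolvent (star a))
  rw [pair_star_of_nonneg hω, star_star, star_add, star_mul', ← pair_star_of_nonneg hτ.nonneg,
    ← pair_star_of_nonneg hω, star_mul, star_star, hs, hτ.tracial] at h2
  have hn : ((n : ℂ)⁻¹) ≠ 0 := inv_ne_zero (Nat.cast_ne_zero.2 hh.pos.ne')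
  have h3 : star ((n : ℂ)⁻¹) = (n : ℂ)⁻¹ := by simp
  rw [h3] at h2
  exact mul_left_cancel₀ hn (by linear_combination h2 - h1)

/-- Together with `pair_mul_eq`, this expands one value `ω (h a)` through `h * k` and through `k *
h`; the comparison yields commutation. -/
lemma pair_eq (hτ : IsFaithfulTrace e τ) (hω : ∀ a : M, 0 ≤ a → 0 ≤ pair e ω a)
    (hh : IsTruncation e τ ω n h) (hk : IsTruncation e τ ω m k) (a : M) :
    pair e ω (h * a) = pair e τ (h * k * a) + (m : ℂ)⁻¹ * pair e ω (h * k * a) := by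
  rw [hh.pair_mul_comm hτ hω, hk.resolvent, mul_assoc h k a, hh.pair_mul_comm hτ hω (k * a),
    hτ.tracial h (k * a), mul_assoc]

lemma pair_mul_eq (h : M) (hk : IsTruncation e τ ω m k) (a : M) :
    pair e ω (h * a) = pair e τ (k * h * a) + (m : ℂ)⁻¹ * pair e ω (k * h * a) := by
  rw [hk.resolvent, mul_assoc]

lemma commute (hτ : IsFaithfulTrace e τ) (hω : ∀ a : M, 0 ≤ a → 0 ≤ pair e ω a)
    (hh : IsTruncation e τ ω n h) (hk : IsTruncation e τ ω m k) : Commute h k := by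
  set c := h * k - k * h with hc
  have hca (a : M) : pair e τ (c * a) + (m : ℂ)⁻¹ * pair e ω (c * a) = 0 := by
    have h1 := hh.pair_eq hτ hω hk a
    have h2 := hk.pair_mul_eq h a
    rw [hc, sub_mul, pair_sub, pair_sub]
    linear_combination h2 - h1
  -- At `a = star c` both summands of `hca` are nonnegative, so each vanishes, and faithfulness of
  -- `τ` gives `c = 0`.
  have h1 := hτ.nonneg _ (mul_star_self_nonneg c)
  have h2 := hω _ (mul_star_self_nonneg c)
  have hm : (0 : ℂ) ≤ (m : ℂ)⁻¹ := by
    simp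
  have h3 := ((add_eq_zero_iff_of_nonneg h1 (mul_nonneg hm h2)).1 (hca _)).1
  rw [hτ.tracial] at h3
  exact sub_eq_zero.1 (hτ.faithful c h3)

/-- The resolvent identity: formally `h⁻¹ = ρ⁻¹ + 1 / n` and `k⁻¹ = ρ⁻¹ + 1 / m`, so `h⁻¹ - k⁻¹ = 1
/ n - 1 / m`. The proof is its weak form, eliminating `ω` from four resolvent relations. -/
lemma sub_eq (hτ : IsFaithfulTrace e τ) (hω : ∀ a : M, 0 ≤ a → 0 ≤ pair e ω a)
    (hh : IsTruncation e τ ω n h) (hk : IsTruncation e τ ω m k) :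
    k - h = ((n : ℂ)⁻¹ - (m : ℂ)⁻¹) • (h * k) := by
  refine sub_eq_zero.1 (hτ.eq_zero_of_pair_mul fun a => ?_)
  have h1 := hh.pair_eq hτ hω hk a
  have h2 := hh.pair_mul_eq k a
  have h3 := hh.resolvent a
  have h4 := hk.resolvent a
  rw [sub_mul, sub_mul, smul_mul_assoc, pair_sub, pair_sub, pair_smul]
  linear_combination h3 - h4 + (n : ℂ)⁻¹ * h1 - (m : ℂ)⁻¹ * h2

/-- The truncations of a density increase. -/
lemma mono (hτ : IsFaithfulTrace e τ) (hω : ∀ a : M, 0 ≤ a → 0 ≤ pair e ω a)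
    (hh : IsTruncation e τ ω n h) (hk : IsTruncation e τ ω m k) (hnm : n ≤ m) : h ≤ k := by
  have hn : (0 : ℝ) < n := Nat.cast_pos.2 hh.pos
  have h1 : (0 : ℝ) ≤ (n : ℝ)⁻¹ - (m : ℝ)⁻¹ :=
    sub_nonneg.2 (inv_anti₀ hn (Nat.cast_le.2 hnm))
  have h2 : (0 : ℂ) ≤ (n : ℂ)⁻¹ - (m : ℂ)⁻¹ := by
    have := Complex.zero_le_real.2 h1
    simpa using this
  rw [← sub_nonneg, hh.sub_eq hτ hω hk]
  exact smul_nonneg h2 ((hh.commute hτ hω hk).mul_nonneg hh.nonneg hk.nonneg)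

end IsTruncation

end Truncation

/-! ### The weighted norms -/

section Weight

variable {M X H : Type*} [CStarAlgebra M] [PartialOrder M] [StarOrderedRing M]
  [NormedAddCommGroup X] [NormedSpace ℂ X] [CompleteSpace X]
  [NormedAddCommGroup H] [InnerProductSpace ℂ H] [CompleteSpace H]
  {e : M ≃ₗᵢ[ℂ] StrongDual ℂ X}

lemma isQuadratic_ofReal_inner {K : Type*} [NormedAddCommGroup K] [InnerProductSpace ℂ K]
    (p : H →L[ℂ] K) {T : K →L[ℂ] K} (hT : T.IsPositive) :
    IsQuadratic (fun V : H => ENNReal.ofReal (RCLike.re ⟪p V, T (p V)⟫_ℂ)) := by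
  have hpos (V : H) : 0 ≤ RCLike.re ⟪p V, T (p V)⟫_ℂ := hT.re_inner_nonneg_right _
  have key (V W : H) : RCLike.re ⟪p (V + W), T (p (V + W))⟫_ℂ = RCLike.re ⟪p V, T (p V)⟫_ℂ
      + RCLike.re ⟪p V, T (p W)⟫_ℂ + RCLike.re ⟪p W, T (p V)⟫_ℂ + RCLike.re ⟪p W, T (p W)⟫_ℂ := by
    simp only [map_add, inner_add_left, inner_add_right]; ring
  have key' (V W : H) : RCLike.re ⟪p (V - W), T (p (V - W))⟫_ℂ = RCLike.re ⟪p V, T (p V)⟫_ℂ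
      - RCLike.re ⟪p V, T (p W)⟫_ℂ - RCLike.re ⟪p W, T (p V)⟫_ℂ + RCLike.re ⟪p W, T (p W)⟫_ℂ := by
    simp only [map_sub, inner_sub_left, inner_sub_right]; ring
  constructor
  · intro z V
    rw [← ENNReal.ofReal_mul (by positivity)]
    congr 1
    rw [map_smul, map_smul, inner_smul_left, inner_smul_right, ← mul_assoc, RCLike.conj_mul,
      ← RCLike.ofReal_pow, RCLike.re_ofReal_mul]
  · intro V W
    rw [show (2 : ℝ≥0∞) = ENNReal.ofReal 2 by simp, ← ENNReal.ofReal_mul zero_le_two,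
      ← ENNReal.ofReal_mul zero_le_two, ← ENNReal.ofReal_add (hpos _) (hpos _),
      ← ENNReal.ofReal_add (by have := hpos V; positivity) (by have := hpos W; positivity)]
    congr 1
    rw [key, key']; ring
  · intro x y z
    rw [← ENNReal.ofReal_add (hpos _) (hpos _), ← ENNReal.ofReal_add (hpos _) (hpos _),
      ← ENNReal.ofReal_add (add_nonneg (hpos _) (hpos _)) (hpos _),
      ← ENNReal.ofReal_add (add_nonneg (hpos _) (hpos _)) (hpos _)]
    congr 1
    simp only [key', map_add, inner_add_left, inner_add_right]; ring
  · intro t ht x z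
    rw [← ENNReal.ofReal_mul ht, ← ENNReal.ofReal_mul ht,
      ← ENNReal.ofReal_add (hpos _) (mul_nonneg ht (hpos _)),
      ← ENNReal.ofReal_add (hpos _) (mul_nonneg ht (hpos _))]
    congr 1
    simp only [key, key', map_smul, inner_smul_left, inner_smul_right, Complex.conj_ofReal]
    simp only [RCLike.re_to_complex, Complex.re_ofReal_mul]
    ring

namespace FirstOrderStructure

variable (S : FirstOrderStructure e H)

lemma l_nonneg {h : M}
    (hh : 0 ≤ h) : 0 ≤ S.l h := by
  obtain ⟨b, rfl⟩ := CStarAlgebra.nonneg_iff_eq_star_mul_self.1 hh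
  rw [map_mul, map_star]
  exact star_mul_self_nonneg _

lemma r_nonneg {h : M}
    (hh : 0 ≤ h) : 0 ≤ S.r (MulOpposite.op h) := by
  obtain ⟨b, rfl⟩ := CStarAlgebra.nonneg_iff_eq_star_mul_self.1 hh
  rw [MulOpposite.op_mul, MulOpposite.op_star, map_mul, map_star]
  exact mul_star_self_nonneg _

lemma l_mono {h k : M}
    (hk : h ≤ k) : S.l h ≤ S.l k := by
  rw [← sub_nonneg, ← map_sub]
  exact S.l_nonneg (sub_nonneg.2 hk)

lemma r_mono {h k : M}
    (hk : h ≤ k) : S.r (MulOpposite.op h) ≤ S.r (MulOpposite.op k) := by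
  rw [← sub_nonneg, ← map_sub, ← MulOpposite.op_sub]
  exact S.r_nonneg (sub_nonneg.2 hk)

end FirstOrderStructure

namespace MeanFamily

variable {S : FirstOrderStructure e H}
  {J : Type*} {K : J → Type*} [∀ j, NormedAddCommGroup (K j)] [∀ j, InnerProductSpace ℂ (K j)]
  [∀ j, CompleteSpace (K j)] (F : MeanFamily S K)

lemma compress_nonneg (j : J) {T : H →L[ℂ] H} (hT : 0 ≤ T) : 0 ≤ F.compress j T := by
  rw [ContinuousLinearMap.nonneg_iff_isPositive] at hT ⊢
  exact hT.adjoint_conj _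

lemma compress_mono (j : J) {T T' : H →L[ℂ] H} (hT : T ≤ T') :
    F.compress j T ≤ F.compress j T' := by
  have h := F.compress_nonneg j (sub_nonneg.2 hT)
  rw [← sub_nonneg]
  convert h using 1
  ext v
  simp [compress]

lemma weightOp_nonneg (j : J) {h : M} (hh : 0 ≤ h) : 0 ≤ F.weightOp j h :=
  (F.mean j).nonneg _ _ (F.compress_nonneg j (S.l_nonneg hh)) (F.compress_nonneg j (S.r_nonneg hh))

lemma weightOp_mono (j : J) {h k : M} (hh : 0 ≤ h) (hk : h ≤ k) :
    F.weightOp j h ≤ F.weightOp j k :=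
  (F.mean j).mono _ _ _ _ (F.compress_nonneg j (S.l_nonneg hh))
    (F.compress_nonneg j (S.r_nonneg hh)) (F.compress_mono j (S.l_mono hk))
    (F.compress_mono j (S.r_mono hk))

lemma form_mono {h k : M} (hh : 0 ≤ h) (hk : h ≤ k) : F.form h ≤ F.form k := by
  intro V
  refine ENNReal.tsum_le_tsum fun j => ENNReal.ofReal_le_ofReal ?_
  have h1 := (ContinuousLinearMap.le_def _ _).1 (F.weightOp_mono j hh hk)
  have h2 := h1.re_inner_nonneg_right (F.proj j V)
  rw [_root_.sub_apply, inner_sub_right, map_sub] at h2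
  exact sub_nonneg.1 h2

lemma isQuadratic_form {h : M} (hh : 0 ≤ h) : IsQuadratic (F.form h) :=
  IsQuadratic.tsum fun j => isQuadratic_ofReal_inner (F.proj j)
    ((ContinuousLinearMap.nonneg_iff_isPositive _).1 (F.weightOp_nonneg j hh))

/-- The weighted norm of a normal state is given by a quadratic form. -/
lemma isQuadratic_weightSq {τ ω : X} (hτ : IsFaithfulTrace e τ)
    (hω : ∀ a : M, 0 ≤ a → 0 ≤ pair e ω a) : IsQuadratic (F.weightSq τ ω) := by
  -- Pairs are ordered componentwise. Monotonicity of truncations makes comparison of the indices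
  -- `n` sufficient, so the set is directed; it need not be known to be nonempty.
  let ι := {i : ℕ × M // IsTruncation e τ ω i.1 i.2}
  have hle (i j : ι) (h : i.1.1 ≤ j.1.1) : i ≤ j := ⟨h, i.2.mono hτ hω j.2 h⟩
  have : IsDirectedOrder ι := ⟨fun i j => by
    rcases le_total i.1.1 j.1.1 with h | h
    · exact ⟨j, hle i j h, le_refl _⟩
    · exact ⟨i, le_refl _, hle j i h⟩⟩
  have hmono : Monotone fun i : ι => F.form i.1.2 := fun i j hij =>
    F.form_mono i.2.nonneg hij.2
  have h := IsQuadratic.iSup hmono fun i => F.isQuadratic_form i.2.nonneg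
  convert h using 2 with V
  simp only [weightSq, ι, iSup_subtype, iSup_prod]

lemma weightNorm_lt_top_iff {τ ω : X} {V : H} :
    F.weightNorm τ ω V < ∞ ↔ F.weightSq τ ω V < ∞ := by
  simp [weightNorm, ENNReal.rpow_lt_top_iff_of_pos]

lemma weightNorm_sq (τ ω : X) (V : H) : F.weightNorm τ ω V ^ 2 = F.weightSq τ ω V := by
  rw [weightNorm, ← ENNReal.rpow_natCast, ← ENNReal.rpow_mul]
  norm_num

lemma toReal_weightNorm (τ ω : X) (V : H) :
    (F.weightNorm τ ω V).toReal = √(F.weightSq τ ω V).toReal := by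
  rw [← weightNorm_sq, ENNReal.toReal_pow, Real.sqrt_sq ENNReal.toReal_nonneg]

end MeanFamily

end Weight

/-! ### Contraction of the transport distance -/

section Contraction

open Filter MeasureTheory

variable {M X H : Type*} [CStarAlgebra M] [PartialOrder M] [StarOrderedRing M]
  [NormedAddCommGroup X] [NormedSpace ℂ X] [CompleteSpace X]
  [NormedAddCommGroup H] [InnerProductSpace ℂ H] [CompleteSpace H]
  {e : M ≃ₗᵢ[ℂ] StrongDual ℂ X} {S : FirstOrderStructure e H}
  {J : Type*} {K : J → Type*} [∀ j, NormedAddCommGroup (K j)] [∀ j, InnerProductSpace ℂ (K j)]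
  [∀ j, CompleteSpace (K j)]

namespace QuantumChannel

variable (P : QuantumChannel e)

lemma nonneg_toFun {a : M} (ha : 0 ≤ a) : 0 ≤ P.toFun a := by
  have h := OrderHomClass.mono P.toCompletelyPositiveMap ha
  rw [map_zero] at h
  exact h

lemma preadjoint_mem_normalStates {ω : X} (hω : ω ∈ normalStates e) :
    P.preadjoint ω ∈ normalStates e := by
  refine ⟨fun a ha => ?_, ?_⟩
  · rw [P.pair_preadjoint']
    exact hω.1 _ (P.nonneg_toFun ha)
  · rw [P.pair_preadjoint']
    exact (congrArg (pair e ω) P.map_one').trans hω.2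

lemma isCurve_preadjoint {ω₁ ω₂ : X} {γ : ℝ → X} (hγ : IsCurve e ω₁ ω₂ γ) :
    IsCurve e (P.preadjoint ω₁) (P.preadjoint ω₂) (fun t => P.preadjoint (γ t)) where
  start := by rw [hγ.start]
  finish := by rw [hγ.finish]
  mem t ht := P.preadjoint_mem_normalStates (hγ.mem t ht)
  absolutelyContinuous := by
    have h := hγ.absolutelyContinuous
    unfold AbsolutelyContinuousOnInterval at h ⊢
    refine squeeze_zero (fun E => Finset.sum_nonneg fun i _ => dist_nonneg) (fun E => ?_)
      (by simpa using h.const_mul ‖P.preadjoint‖)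
    rw [Finset.mul_sum]
    exact Finset.sum_le_sum fun i _ => P.preadjoint.dist_le_opNorm _ _
  differentiable := by
    filter_upwards [hγ.differentiable] with t ht
    exact (P.preadjoint.restrictScalars ℝ).differentiableAt.comp t ht

lemma deriv_preadjoint {γ : ℝ → X} {t : ℝ} (ht : DifferentiableAt ℝ γ t) :
    deriv (fun s => P.preadjoint (γ s)) t = P.preadjoint (deriv γ t) :=
  ((P.preadjoint.restrictScalars ℝ).hasFDerivAt.comp_hasDerivAt t ht.hasDerivAt).deriv

end QuantumChannel

variable {F : MeanFamily S K} {τ : X} {P : QuantumChannel e} {κ : ℝ}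

/-- Lets the case `κ = 1` be approached through `κ' < 1`. -/
lemma GradientEstimate.mono {κ' : ℝ} (hP : GradientEstimate F τ P κ) (h : κ' ≤ κ) :
    GradientEstimate F τ P κ' := by
  intro x
  obtain ⟨hx, hle⟩ := hP x
  refine ⟨hx, fun ρ hρ hfin => (hle ρ hρ hfin).trans ?_⟩
  gcongr

namespace MeanFamily

/-- The value of a tangent vector at `a` is bounded by the energy of its velocity. -/
lemma IsVelocity.norm_pair_le {ω x : X} {V : ℕ → H} {E : ℝ≥0∞} (hτ : IsFaithfulTrace e τ)
    (hω : ∀ a : M, 0 ≤ a → 0 ≤ pair e ω a) (hV : F.IsVelocity τ ω x V E) (hE : E ≠ ∞) (a : S.A)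
    (ha : F.weightNorm τ ω (S.d a) < ∞) :
    ‖pair e x a‖ ≤ √E.toReal * (F.weightNorm τ ω (S.d a)).toReal := by
  have hq := F.isQuadratic_weightSq hτ hω
  rw [toReal_weightNorm]
  refine le_of_tendsto_of_tendsto (hV.divergence a ha).norm
    ((((ENNReal.tendsto_toReal hE).comp hV.energy).sqrt).mul_const _) (Eventually.of_forall fun k => ?_)
  exact hq.isRealQuadratic.norm_polarize_le ⟨V k, F.weightNorm_lt_top_iff.1 (hV.finite k)⟩
    ⟨S.d a, F.weightNorm_lt_top_iff.1 ha⟩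

/-- A functional on the domain of the derivation that is bounded by the weighted norm of the
gradient has a velocity. -/
lemma exists_isVelocity {σ y : X} (hτ : IsFaithfulTrace e τ)
    (hσ : ∀ a : M, 0 ≤ a → 0 ≤ pair e σ a) {C : ℝ} (hC : 0 ≤ C)
    (h : ∀ a : S.A, F.weightNorm τ σ (S.d a) < ∞ →
      ‖pair e y a‖ ≤ C * (F.weightNorm τ σ (S.d a)).toReal) :
    ∃ (W : ℕ → H) (E : ℝ≥0∞), E ≤ ENNReal.ofReal (C ^ 2) ∧ F.IsVelocity τ σ y W E := by
  have hq := F.isQuadratic_weightSq hτ hσ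
  -- Only elements whose gradient has finite weighted norm are tested in `IsVelocity`; they form a
  -- subspace.
  let A' : Submodule ℂ S.A := hq.finiteDomain.comap S.d
  let T : A' →ₗ[ℂ] hq.finiteDomain := S.d.restrict fun a ha => ha
  let f : A' →ₗ[ℂ] ℂ := pairLinear e y ∘ₗ S.A.toSubmodule.subtype ∘ₗ A'.subtype
  obtain ⟨W, b, hb, hcauchy, henergy, hdiv⟩ := hq.isRealQuadratic.exists_seq_polarize_tendsto T f hC
    (fun a => by
      have := h a (F.weightNorm_lt_top_iff.2 a.2)
      rwa [toReal_weightNorm] at this)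
  have hfin (w : hq.finiteDomain) : F.weightSq τ σ w ≠ ∞ := (hq.mem_finiteDomain.1 w.2).ne
  refine ⟨fun k => W k, ENNReal.ofReal b, ENNReal.ofReal_le_ofReal hb,
    fun k => F.weightNorm_lt_top_iff.2 (W k).2, ?_, ?_, fun a ha => ?_⟩
  · have h1 := (ENNReal.continuous_ofReal.tendsto 0).comp hcauchy
    rw [ENNReal.ofReal_zero] at h1
    have h2 := (ENNReal.continuous_rpow_const (y := (1 / 2 : ℝ))).tendsto 0 |>.comp h1
    rw [ENNReal.zero_rpow_of_pos (by norm_num)] at h2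
    refine h2.congr fun k => ?_
    simp only [Function.comp_apply]
    rw [ENNReal.ofReal_toReal (hfin _)]
    rfl
  · refine ((ENNReal.continuous_ofReal.tendsto b).comp henergy).congr fun k => ?_
    simp only [Function.comp_apply]
    rw [ENNReal.ofReal_toReal (hfin _)]
  · exact hdiv ⟨a, F.weightNorm_lt_top_iff.1 ha⟩

/-- The gradient estimate contracts the metric on tangent vectors. -/
lemma tangentNorm_preadjoint_le (hτ : IsFaithfulTrace e τ) (hκ : κ < 1)
    (hP : GradientEstimate F τ P κ) {ω : X} (hω : ω ∈ normalStates e) (x : X) :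
    F.tangentNorm τ (P.preadjoint ω) (P.preadjoint x)
      ≤ ENNReal.ofReal (1 - κ) * F.tangentNorm τ ω x := by
  have hc : 0 < 1 - κ := by linarith
  have hc0 : ENNReal.ofReal (1 - κ) ≠ 0 := by simpa using hc
  have hct : ENNReal.ofReal (1 - κ) ^ 2 ≠ ∞ := ENNReal.pow_ne_top ENNReal.ofReal_ne_top
  have hsqrt : ENNReal.ofReal (1 - κ) = (ENNReal.ofReal (1 - κ) ^ 2) ^ (1 / 2 : ℝ) := by
    rw [← ENNReal.rpow_natCast, ← ENNReal.rpow_mul]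
    norm_num
  rw [tangentNorm, tangentNorm, hsqrt, ← ENNReal.mul_rpow_of_nonneg _ _ (by norm_num)]
  refine ENNReal.rpow_le_rpow ?_ (by norm_num)
  -- The factor passes through the infimum, which may be `∞`, because it is nonzero; this is where
  -- `κ < 1` enters.
  simp only [ENNReal.mul_iInf_of_ne (pow_ne_zero 2 hc0) hct]
  refine le_iInf fun V => le_iInf fun E => le_iInf fun hV => ?_
  rcases eq_or_ne E ∞ with rfl | hE
  · simp [ENNReal.mul_top (pow_ne_zero 2 hc0)]
  -- The constant is `√E` from Cauchy–Schwarz at `ω` times `1 - κ` from the gradient estimate; its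
  -- square is the required energy bound.
  obtain ⟨W, E', hE', hW⟩ := F.exists_isVelocity (σ := P.preadjoint ω) (y := P.preadjoint x) hτ
    (P.preadjoint_mem_normalStates hω).1 (C := √E.toReal * (1 - κ)) (by positivity)
    (fun a ha => by
      obtain ⟨hx, hle⟩ := hP a
      have h1 := hle ω hω ha
      have h2 : ENNReal.ofReal (1 - κ) * F.weightNorm τ (P.preadjoint ω) (S.d a) < ∞ :=
        ENNReal.mul_lt_top ENNReal.ofReal_lt_top ha
      have h3 := ENNReal.toReal_mono h2.ne h1
      rw [ENNReal.toReal_mul, ENNReal.toReal_ofReal hc.le] at h3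
      -- The gradient estimate also makes the norm of `∂ P a` finite, so `P a` is an admissible test
      -- element for `V`.
      rw [P.pair_preadjoint', mul_assoc]
      exact (hV.norm_pair_le hτ hω.1 hE ⟨P.toFun (a : M), hx⟩ (h1.trans_lt h2)).trans
        (mul_le_mul_of_nonneg_left h3 (Real.sqrt_nonneg _)))
  refine (iInf_le _ W).trans ((iInf_le _ E').trans ((iInf_le _ hW).trans (hE'.trans (le_of_eq ?_))))
  rw [mul_pow, Real.sq_sqrt ENNReal.toReal_nonneg, ENNReal.ofReal_mul ENNReal.toReal_nonneg,
    ENNReal.ofReal_toReal hE, ENNReal.ofReal_pow hc.le, mul_comm]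

end MeanFamily

lemma wasserstein_preadjoint_le_of_lt_one (hτ : IsFaithfulTrace e τ) (hκ : κ < 1)
    (hP : GradientEstimate F τ P κ) (ω₁ ω₂ : X) :
    wasserstein F τ (P.preadjoint ω₁) (P.preadjoint ω₂)
      ≤ ENNReal.ofReal (1 - κ) * wasserstein F τ ω₁ ω₂ := by
  have hc0 : ENNReal.ofReal (1 - κ) ≠ 0 := by simpa using hκ
  simp only [wasserstein, ENNReal.mul_iInf_of_ne hc0 ENNReal.ofReal_ne_top]
  refine le_iInf fun γ => le_iInf fun hγ => ?_
  refine (iInf₂_le _ (P.isCurve_preadjoint hγ)).trans ?_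
  -- A finite constant can be pulled out with no measurability of the speed.
  rw [← lintegral_const_mul' _ _ ENNReal.ofReal_ne_top]
  refine lintegral_mono_ae ?_
  filter_upwards [hγ.differentiable, ae_restrict_mem measurableSet_Icc] with t hd ht
  rw [P.deriv_preadjoint hd]
  exact F.tangentNorm_preadjoint_le hτ hκ hP (hγ.mem t ht) _

/-- The estimate holds with factor `1 / (n + 1)` for every `n`; finiteness of the distance makes the
right side tend to `0`. -/
lemma wasserstein_preadjoint_eq_zero (hτ : IsFaithfulTrace e τ) (hP : GradientEstimate F τ P 1)
    {ω₁ ω₂ : X} (h : wasserstein F τ ω₁ ω₂ < ∞) :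
    wasserstein F τ (P.preadjoint ω₁) (P.preadjoint ω₂) = 0 := by
  have h1 (n : ℕ) : wasserstein F τ (P.preadjoint ω₁) (P.preadjoint ω₂)
      ≤ ENNReal.ofReal (1 / ((n : ℝ) + 1)) * wasserstein F τ ω₁ ω₂ := by
    have hn : 0 < 1 / ((n : ℝ) + 1) := by positivity
    have := wasserstein_preadjoint_le_of_lt_one (κ := 1 - 1 / ((n : ℝ) + 1)) hτ (by linarith)
      (hP.mono (by linarith)) ω₁ ω₂
    rwa [sub_sub_cancel] at this
  have h2 : Tendsto (fun n : ℕ => ENNReal.ofReal (1 / ((n : ℝ) + 1)) * wasserstein F τ ω₁ ω₂) atTop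
      (𝓝 0) := by
    have h3 := ENNReal.tendsto_ofReal (tendsto_one_div_add_atTop_nhds_zero_nat (𝕜 := ℝ))
    have h4 := ENNReal.Tendsto.mul_const (b := wasserstein F τ ω₁ ω₂) h3 (Or.inr h.ne)
    simpa using h4
  exact le_antisymm (ge_of_tendsto' h2 h1) zero_le

end Contraction

end QuantumTransport

end

theorem mainTheorem4 {M X H J : Type*} [CStarAlgebra M] [PartialOrder M] [StarOrderedRing M]
    [NormedAddCommGroup X] [NormedSpace ℂ X] [CompleteSpace X]
    [NormedAddCommGroup H] [InnerProductSpace ℂ H] [CompleteSpace H]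
    {K : J → Type*} [∀ j, NormedAddCommGroup (K j)] [∀ j, InnerProductSpace ℂ (K j)]
    [∀ j, CompleteSpace (K j)]
    (e : M ≃ₗᵢ[ℂ] StrongDual ℂ X) (τ : X) (hτ : QuantumTransport.IsFaithfulTrace e τ)
    (S : QuantumTransport.FirstOrderStructure e H) (F : QuantumTransport.MeanFamily S K)
    (P : QuantumTransport.QuantumChannel e) (κ : ℝ) (hκ : κ ≤ 1)
    (hP : QuantumTransport.GradientEstimate F τ P κ)
    (ω₁ ω₂ : X) (hω₁ : ω₁ ∈ QuantumTransport.normalStates e)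
    (hω₂ : ω₂ ∈ QuantumTransport.normalStates e)
    (h : κ < 1 ∨ QuantumTransport.wasserstein F τ ω₁ ω₂ < ∞) :
    QuantumTransport.wasserstein F τ (P.preadjoint ω₁) (P.preadjoint ω₂) ≤
      ENNReal.ofReal (1 - κ) * QuantumTransport.wasserstein F τ ω₁ ω₂ := by
  rcases hκ.lt_or_eq with hlt | rfl
  · exact QuantumTransport.wasserstein_preadjoint_le_of_lt_one hτ hlt hP ω₁ ω₂
  · rw [QuantumTransport.wasserstein_preadjoint_eq_zero hτ hP (h.resolve_left (lt_irrefl _))]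
    exact zero_le
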